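/- Let $n,q\ge 1$ and let $\mathbf d=(d_1,\dots,d_q)$ be integers with $d_i\ge 1$. Let $\mathbf P_{d}$ be the space of real polynomials in $n$ variables of degree at most $d$, normed by the Euclidean norm of the vector of coefficients, and let $\mathbf P_{\mathbf d}=\mathbf P_{d_1}\times\dots\times\mathbf P_{d_q}$ with the product topology. For a nonempty set $S\subseteq\mathbb R^n$ let $S_\infty=\{v:\ \exists\, t_k\to+\infty,\ x_k\in S \text{ with } x_k/t_k\to v\}$ be its asymptotic cone. For a polynomial $p$ of degree at most $d$ let $p^\infty_d(x)=\lim_{t\to+\infty}p(tx)/t^{d}$, and let $SOL(C,\varphi)$ be the set of global minimizers of $\varphi$ over $C$. Given $K\subseteq\mathbb R^n$, a nonempty index set $I\subseteq\{1,\dots,q\}$ and a set $S\subseteq \mathbb R^n$, a vector polynomial $f=(f_1,\dots,f_q)$ is called relatively $I$-$\mathbb R^q_+$-zero-regular with $S$ on $K$ if $S$ is nonempty and closed and there are $\bar x\in K$ and $\lambda\in\mathbb R^q_+\setminus\{0\}$ with $I=\{i:\lambda_i\ne 0\}$ such that $(K_{\bar x})_\infty\subseteq S_\infty\subseteq K_\infty$,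 where $K_{\bar x}=\{x\in K: f_i(x)\le f_i(\bar x),\ i=1,\dots,q\}$, and such that $SOL\big(S_\infty,(\sum_{i}\lambda_i f_i)^\infty_{d}\big)$ with $d=\deg\sum_i\lambda_i f_i$ is bounded. Let $\mathbf{GR}^{\mathbf d}$ be the set of all $p=(p_1,\dots,p_q)\in\mathbf P_{\mathbf d}$ with $\deg p_i=d_i$ for all $i$ that are relatively $I$-$\mathbb R^q_+$-zero-regular with $S$ on $K$ for some set $S$ and some nonempty $I\subseteq\{1,\dots,q\}$. **Theorem.** Let $K=\{x\in\mathbb R^n: g_i(x)\le 0,\ i=1,\dots,m\}$ be nonempty, where $g_1,\dots,g_m$ are convex polynomials, and suppose that $K_\infty=\{x\in\mathbb R^n: Ax\le 0\}$ for a real matrix $A$ with $n$ columns (and any number of rows) of full rank. Then $\mathbf{GR}^{\mathbf d}$ is generic in $\mathbf P_{\mathbf d}$, that is, it contains a countable intersection of open dense subsets of $\mathbf P_{\mathbf d}$. -/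

import Mathlib

open Filter Topology MvPolynomial

noncomputable section

namespace PolyVectorOpt

/-- The Euclidean space `ℝⁿ`. -/
abbrev E (n : ℕ) : Type := EuclideanSpace ℝ (Fin n)

/-- The value at `x ∈ ℝⁿ` of a real polynomial in `n` variables. -/
def ev {n : ℕ} (p : MvPolynomial (Fin n) ℝ) (x : E n) : ℝ := eval (fun j => x j) p

/-! ### The normed space of polynomials of degree at most `d` -/

/-- `P n d` is the space of real polynomials in `n` variables of degree at most `d`. -/
abbrev P (n d : ℕ) : Type := ↥(restrictTotalDegree (Fin n) ℝ d)

/-- The exponents of the monomials of degree at most `d` in `n` variables. -/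
abbrev Expo (n d : ℕ) : Type := {s : Fin n →₀ ℕ // s.degree ≤ d}

instance (n d : ℕ) : Fintype (Expo n d) := (Finsupp.finite_of_degree_le d).fintype

/-- The vector of coefficients of a polynomial of degree at most `d`. -/
def coeffVec (n d : ℕ) : P n d →ₗ[ℝ] EuclideanSpace ℝ (Expo n d) where
  toFun p := WithLp.toLp 2 fun s => coeff s.1 p.1
  map_add' p q := by ext s; simp
  map_smul' c p := by ext s; simp

theorem coeffVec_injective (n d : ℕ) : Function.Injective (coeffVec n d) := by
  intro p q h
  apply Subtype.ext
  ext s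
  by_cases hs : s.degree ≤ d
  · exact congrArg (fun v : EuclideanSpace ℝ (Expo n d) => v ⟨s, hs⟩) h
  · have key : ∀ r : P n d, coeff s r.1 = 0 := fun r =>
      coeff_eq_zero_of_totalDegree_lt
        (lt_of_le_of_lt ((mem_restrictTotalDegree _ _ _).1 r.2) (not_le.1 hs))
    rw [key p, key q]

/-- The norm of a polynomial of degree at most `d` is the Euclidean norm of its vector of
coefficients. -/
instance (n d : ℕ) : NormedAddCommGroup (P n d) :=
  NormedAddCommGroup.induced (P n d) (EuclideanSpace ℝ (Expo n d)) (coeffVec n d)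
    (coeffVec_injective n d)

theorem norm_eq (n d : ℕ) (p : P n d) :
    ‖p‖ = Real.sqrt (∑ s : Expo n d, coeff s.1 p.1 ^ 2) := by
  change ‖coeffVec n d p‖ = _
  rw [EuclideanSpace.norm_eq]
  simp [coeffVec]

/-- The space `P_{d_1} × ⋯ × P_{d_q}` of vector polynomials, with the product topology. -/
abbrev PVec (n : ℕ) {q : ℕ} (d : Fin q → ℕ) : Type := (i : Fin q) → P n (d i)

/-! ### Asymptotic cones -/

/-- Mathlib's asymptotic cone is the set of the limits of `x k / t k` with `x k ∈ K` and
`t k → +∞`. -/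
theorem mem_asymptoticCone_iff_seq {n : ℕ} (K : Set (E n)) (v : E n) :
    v ∈ asymptoticCone ℝ K ↔ ∃ (t : ℕ → ℝ) (x : ℕ → E n), Tendsto t atTop atTop ∧
      (∀ k, x k ∈ K) ∧ Tendsto (fun k => (t k)⁻¹ • x k) atTop (𝓝 v) := by
  constructor
  · intro h
    rw [mem_asymptoticCone_iff, AffineSpace.asymptoticNhds_eq_smul, ← map₂_smul,
      ← map_prod_eq_map₂, frequently_map] at h
    obtain ⟨u, hu, hK⟩ := exists_seq_forall_of_frequently h
    rw [tendsto_prod_iff'] at hu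
    refine ⟨fun k => (u k).1, fun k => (u k).1 • (u k).2, hu.1, hK, hu.2.congr' ?_⟩
    filter_upwards [hu.1.eventually_gt_atTop 0] with k hk
    rw [smul_smul, inv_mul_cancel₀ hk.ne', one_smul]
  · rintro ⟨t, x, ht, hx, hv⟩
    rw [mem_asymptoticCone_iff]
    have h := ht.atTop_smul_nhds_tendsto_asymptoticNhds hv
    refine h.frequently (Eventually.frequently ?_)
    filter_upwards [ht.eventually_gt_atTop 0] with k hk
    rw [smul_smul, mul_inv_cancel₀ hk.ne', one_smul]
    exact hx k

/-! ### Recession polynomials and solution sets -/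

/-- The recession polynomial `p^∞_d (x) = lim_{t → +∞} p (t x) / t ^ d`. -/
def recession {n : ℕ} (p : MvPolynomial (Fin n) ℝ) (d : ℕ) (x : E n) : ℝ :=
  limUnder atTop fun t : ℝ => ev p (t • x) / t ^ d

/-- The limit in the definition of `recession` exists when the degree of `p` is at most `d`; it is
the value of the homogeneous part of degree `d`. -/
theorem tendsto_recession {n : ℕ} {p : MvPolynomial (Fin n) ℝ} {d : ℕ} (hp : p.totalDegree ≤ d)
    (x : E n) : Tendsto (fun t : ℝ => ev p (t • x) / t ^ d) atTop
      (𝓝 (ev (homogeneousComponent d p) x)) := by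
  have hsum : ∑ i ∈ Finset.range (d + 1), homogeneousComponent i p = p := by
    conv_rhs => rw [← sum_homogeneousComponent p]
    symm
    apply Finset.sum_subset
    · intro i hi
      simp only [Finset.mem_range] at hi ⊢
      omega
    · intro i _ hi
      apply homogeneousComponent_eq_zero
      simpa using hi
  have hev : ∀ t : ℝ, ev p (t • x) =
      ∑ i ∈ Finset.range (d + 1), t ^ i * ev (homogeneousComponent i p) x := by
    intro t
    conv_lhs => rw [← hsum]
    unfold ev
    rw [map_sum]
    refine Finset.sum_congr rfl fun i _ => ?_
    rw [eval_eq, eval_eq, Finset.mul_sum]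
    refine Finset.sum_congr rfl fun s hs => ?_
    have hdeg : s.degree = i := by
      have := homogeneousComponent_isHomogeneous i p (mem_support_iff.1 hs)
      simpa [Finsupp.degree_eq_weight_one, Pi.one_def] using this
    have hprod : ∏ j ∈ s.support, t ^ s j = t ^ i := by
      rw [Finset.prod_pow_eq_pow_sum, ← hdeg, Finsupp.degree_apply]
    simp only [PiLp.smul_apply, smul_eq_mul, mul_pow, Finset.prod_mul_distrib]
    rw [hprod]
    ring
  have hlim : Tendsto (fun t : ℝ => ∑ i ∈ Finset.range (d + 1),
      t ^ i / t ^ d * ev (homogeneousComponent i p) x) atTop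
      (𝓝 (∑ i ∈ Finset.range (d + 1),
        (if i = d then 1 else 0) * ev (homogeneousComponent i p) x)) := by
    refine tendsto_finsetSum _ fun i hi => Tendsto.mul_const _ ?_
    rcases (Finset.mem_range_succ_iff.1 hi).eq_or_lt with rfl | hlt
    · rw [if_pos rfl]
      refine tendsto_const_nhds.congr' ?_
      filter_upwards [eventually_gt_atTop 0] with t ht
      rw [div_self (pow_pos ht _).ne']
    · rw [if_neg hlt.ne]
      exact tendsto_pow_div_pow_atTop_zero hlt
  simp only [ite_mul, one_mul, zero_mul, Finset.sum_ite_eq', Finset.self_mem_range_succ,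
    if_true] at hlim
  refine hlim.congr fun t => ?_
  rw [hev, Finset.sum_div]
  exact Finset.sum_congr rfl fun i _ => by ring

theorem recession_eq {n : ℕ} {p : MvPolynomial (Fin n) ℝ} {d : ℕ} (hp : p.totalDegree ≤ d)
    (x : E n) : recession p d x = ev (homogeneousComponent d p) x :=
  (tendsto_recession hp x).limUnder_eq

/-- The set `SOL(C, φ)` of the (global) minimizers of `φ` over `C`. -/
def SOL {n : ℕ} (C : Set (E n)) (φ : E n → ℝ) : Set (E n) :=
  {x | x ∈ C ∧ ∀ y ∈ C, φ x ≤ φ y}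

/-- The polynomial `p` is regular on `S`: the solution set `SOL(S_∞, p^∞_d)` is bounded, where
`d = deg p`. -/
def IsRegularOn {n : ℕ} (S : Set (E n)) (p : MvPolynomial (Fin n) ℝ) : Prop :=
  Bornology.IsBounded (SOL (asymptoticCone ℝ S) (recession p p.totalDegree))

/-- The sublevel set `{x ∈ K | f_i x ≤ f_i x₀ for all i}`. -/
def sublevel {n q : ℕ} (K : Set (E n)) (f : Fin q → MvPolynomial (Fin n) ℝ) (x₀ : E n) :
    Set (E n) :=
  {x | x ∈ K ∧ ∀ i, ev (f i) x ≤ ev (f i) x₀}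

/-- The vector polynomial `f` is relatively `I`-`ℝ^q_+`-zero-regular with `S` on `K`. -/
def IsRelZeroRegular {n q : ℕ} (K : Set (E n)) (f : Fin q → MvPolynomial (Fin n) ℝ)
    (I : Set (Fin q)) (S : Set (E n)) : Prop :=
  S.Nonempty ∧ IsClosed S ∧ ∃ x₀ ∈ K,
    asymptoticCone ℝ (sublevel K f x₀) ⊆ asymptoticCone ℝ S ∧
    asymptoticCone ℝ S ⊆ asymptoticCone ℝ K ∧
    ∃ w : Fin q → ℝ, (∀ i, 0 ≤ w i) ∧ w ≠ 0 ∧ I = {i | w i ≠ 0} ∧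
      IsRegularOn S (∑ i, w i • f i)

/-- The family `GR^d` of the vector polynomials `p` with `deg p_i = d_i` for all `i` that are
relatively `I`-`ℝ^q_+`-zero-regular with `S` on `K` for some set `S` and some nonempty `I`. -/
def GR {n q : ℕ} (K : Set (E n)) (d : Fin q → ℕ) : Set (PVec n d) :=
  {p | (∀ i, (p i).1.totalDegree = d i) ∧
    ∃ (S : Set (E n)) (I : Set (Fin q)), I.Nonempty ∧
      IsRelZeroRegular K (fun i => (p i).1) I S}

/-- A subset of a topological space is generic if it contains a countable intersection of open
dense sets. -/
def IsGeneric {X : Type*} [TopologicalSpace X] (G : Set X) : Prop :=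
  ∃ U : ℕ → Set X, (∀ k, IsOpen (U k)) ∧ (∀ k, Dense (U k)) ∧ ⋂ k, U k ⊆ G

end PolyVectorOpt

end

/-! Take `S = K` and put all the weight on a single objective: both cone inclusions become trivial,
and only the minimizers of one leading form on the cone `K_∞` have to be bounded. By homogeneity of
positive degree there are none if the form is negative somewhere on the cone, and only the origin if
it is positive off the origin. The bad case is a form that is nonnegative on the cone with a nonzero
zero there, and an arbitrarily small perturbation makes it negative at that zero. Hence the good
polynomials (`regularPolys`) form an open dense set, and so does their product over the objectives.
-/

open PolyVectorOpt in
/-- The homogeneous part of degree `d` of a polynomial of degree at most `d`, as an explicit sum. -/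
theorem ev_homogeneousComponent_eq_sum {n d : ℕ} (p : P n d) (x : E n) :
    ev (homogeneousComponent d p.1) x =
      ∑ s : Expo n d, if s.1.degree = d then coeff s.1 p.1 * ∏ j, x j ^ s.1 j else 0 := by
  classical
  have hsub : (homogeneousComponent d p.1).support ⊆
      Finset.univ.image (fun s : Expo n d => s.1) := by
    intro s hs
    rw [mem_support_iff, coeff_homogeneousComponent] at hs
    have h : s.degree = d := by
      by_contra h
      exact hs (if_neg h)
    exact Finset.mem_image.2 ⟨⟨s, h.le⟩, Finset.mem_univ _, rfl⟩
  unfold ev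
  rw [eval_eq', Finset.sum_subset hsub, Finset.sum_image (fun a _ b _ h => Subtype.ext h)]
  · refine Finset.sum_congr rfl fun s _ => ?_
    rw [coeff_homogeneousComponent, ite_mul, zero_mul]
  · intro s _ hs
    rw [notMem_support_iff.1 hs, zero_mul]

open PolyVectorOpt in
open scoped MvPowerSeries.WithPiTopology in
/-- The topology of `P n d` is that of convergence of the coefficients. -/
theorem continuous_polys_iff {X : Type*} [TopologicalSpace X] {n d : ℕ} {f : X → P n d} :
    Continuous f ↔ ∀ s, Continuous fun x => coeff s (f x).1 :=
  (Topology.IsInducing.subtypeVal.continuous_iff.trans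
    (MvPolynomial.toMvPowerSeries_isUniformInducing (σ := Fin n)
      (R := ℝ)).isInducing.continuous_iff).trans continuous_pi_iff

open PolyVectorOpt in
theorem continuous_coeff {n d : ℕ} (s : Fin n →₀ ℕ) : Continuous fun p : P n d => coeff s p.1 :=
  continuous_polys_iff.1 continuous_id s

open PolyVectorOpt in
/-- The topology of `P n d` is that of the Euclidean norm of the vector of coefficients. -/
theorem isInducing_coeffVec (n d : ℕ) : Topology.IsInducing (coeffVec n d) := by
  refine ⟨le_antisymm (continuous_iff_le_induced.1 ?_) (continuous_id_iff_le.1 ?_)⟩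
  · exact (PiLp.continuous_toLp 2 _).comp (continuous_pi fun s => continuous_coeff s.1)
  · let τ : TopologicalSpace (P n d) := .induced (coeffVec n d) inferInstance
    refine (@continuous_polys_iff _ τ n d id).2 fun s => ?_
    by_cases hs : s.degree ≤ d
    · have hproj : Continuous fun x : EuclideanSpace ℝ (Expo n d) => x ⟨s, hs⟩ := by fun_prop
      have hvec : @Continuous _ _ τ _ (coeffVec n d) := continuous_induced_dom
      exact @Continuous.comp _ _ _ τ _ _ _ _ hproj hvec
    · have h : (fun p : P n d => coeff s (id p).1) = fun _ => 0 := funext fun p =>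
        coeff_eq_zero_of_totalDegree_lt
          (((mem_restrictTotalDegree _ _ _).1 p.2).trans_lt (not_le.1 hs))
      rw [h]
      exact @continuous_const _ _ τ _ _

open PolyVectorOpt in
/-- The value at `x` of the homogeneous part of degree `d` of `p`. -/
noncomputable def leadingForm {n d : ℕ} (p : P n d) (x : E n) : ℝ :=
  ev (homogeneousComponent d p.1) x

open PolyVectorOpt in
theorem continuous_leadingForm {n d : ℕ} :
    Continuous fun z : P n d × E n => leadingForm z.1 z.2 := by
  unfold leadingForm
  simp only [ev_homogeneousComponent_eq_sum]
  refine continuous_finsetSum _ fun s _ => ?_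
  split_ifs
  · exact ((continuous_coeff s.1).comp continuous_fst).mul (by fun_prop)
  · exact continuous_const

open PolyVectorOpt in
theorem continuous_leadingForm_left {n d : ℕ} (v : E n) :
    Continuous fun p : P n d => leadingForm p v := by
  have h : Continuous fun p : P n d => (p, v) := Continuous.prodMk_left v
  have hcomp := continuous_leadingForm.comp h
  exact hcomp

open PolyVectorOpt in
theorem continuous_add_smul {n d : ℕ} (p r : P n d) : Continuous fun t : ℝ => p + t • r := by
  refine (isInducing_coeffVec n d).continuous_iff.2 ?_
  have h : (coeffVec n d ∘ fun t : ℝ => p + t • r) =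
      fun t : ℝ => coeffVec n d p + t • coeffVec n d r := by
    ext1 t
    simp
  rw [h]
  fun_prop

open PolyVectorOpt in
theorem leadingForm_smul {n d : ℕ} (p : P n d) (c : ℝ) (x : E n) :
    leadingForm p (c • x) = c ^ d * leadingForm p x := by
  simp only [leadingForm, ev, eval_eq, PiLp.smul_apply, smul_eq_mul, mul_pow,
    Finset.prod_mul_distrib, Finset.mul_sum]
  refine Finset.sum_congr rfl fun s hs => ?_
  have hdeg : s.degree = d := by
    by_contra h
    exact mem_support_iff.1 hs ((coeff_homogeneousComponent d p.1 s).trans (if_neg h))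
  rw [Finset.prod_pow_eq_pow_sum, ← Finsupp.degree_apply, hdeg]
  ring

open PolyVectorOpt in
theorem leadingForm_add_smul {n d : ℕ} (p r : P n d) (t : ℝ) (x : E n) :
    leadingForm (p + t • r) x = leadingForm p x + t * leadingForm r x := by
  simp [leadingForm, ev, smul_eval]

open PolyVectorOpt in
/-- For every nonzero vector there is a form of degree `d` with value `1` there. -/
theorem exists_leadingForm_eq_one {n d : ℕ} {v : E n} (hv : v ≠ 0) :
    ∃ r : P n d, leadingForm r v = 1 := by
  obtain ⟨j, hj⟩ : ∃ j, v j ≠ 0 := by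
    by_contra! h
    exact hv (by ext j; simpa using h j)
  have hhom : (monomial (Finsupp.single j d) ((v j ^ d)⁻¹)).IsHomogeneous d :=
    isHomogeneous_monomial _ (by simp)
  refine ⟨⟨monomial (Finsupp.single j d) ((v j ^ d)⁻¹), ?_⟩, ?_⟩
  · rw [mem_restrictTotalDegree]
    exact hhom.totalDegree_le
  · simp only [leadingForm, homogeneousComponent_of_mem hhom, if_true, ev, eval_monomial]
    rw [Finsupp.prod_single_index (by simp)]
    exact inv_mul_cancel₀ (pow_ne_zero _ hj)

open PolyVectorOpt in
/-- The polynomials of degree exactly `d` whose leading form is negative somewhere on `C` or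
positive on `C ∖ {0}`. -/
def regularPolys (n d : ℕ) (C : Set (E n)) : Set (P n d) :=
  {p | (∃ v, leadingForm p v ≠ 0) ∧
    ((∃ v ∈ C, leadingForm p v < 0) ∨
      ∀ v ∈ C, v ≠ 0 → 0 < leadingForm p v)}

-- The first two conditions are strict inequalities at some point, hence open. Positivity on the
-- cone reduces by homogeneity to its compact trace on the unit sphere, where joint continuity makes
-- it stable.
open PolyVectorOpt in
theorem isOpen_regularPolys {n d : ℕ} {C : Set (E n)} (hC : IsClosed C)
    (hcone : ∀ c : ℝ, 0 < c → ∀ v ∈ C, c • v ∈ C) : IsOpen (regularPolys n d C) := by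
  have hcont := continuous_leadingForm_left (n := n) (d := d)
  have hpos : {p : P n d | ∀ v ∈ C, v ≠ 0 → 0 < leadingForm p v} =
      {p : P n d | ∀ v ∈ C ∩ Metric.sphere 0 1, 0 < leadingForm p v} := by
    ext p
    refine ⟨fun h v hv => h v hv.1 fun h0 => ?_, fun h v hv hv0 => ?_⟩
    · simpa [h0] using hv.2
    · have hn : 0 < ‖v‖⁻¹ := inv_pos.2 (norm_pos_iff.2 hv0)
      have := h (‖v‖⁻¹ • v) ⟨hcone _ hn v hv, by simp [norm_smul, hv0]⟩
      rw [leadingForm_smul] at this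
      exact (pos_iff_pos_of_mul_pos this).1 (pow_pos hn d)
  have h1 : IsOpen {p : P n d | ∃ v, leadingForm p v ≠ 0} := by
    simp only [Set.ofPred_exists]
    exact isOpen_iUnion fun v => isOpen_ne_fun (hcont v) continuous_const
  have h2 : IsOpen {p : P n d | ∃ v ∈ C, leadingForm p v < 0} := by
    simp only [Set.ofPred_exists, ← exists_prop]
    exact isOpen_iUnion fun v => isOpen_iUnion fun _ => isOpen_lt (hcont v) continuous_const
  have h3 : IsOpen {p : P n d | ∀ v ∈ C, v ≠ 0 → 0 < leadingForm p v} := by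
    rw [hpos, isOpen_iff_mem_nhds]
    intro p hp
    exact ((isCompact_sphere (0 : E n) 1).inter_left hC).eventually_forall_of_forall_eventually
      fun v hv => continuous_leadingForm.continuousAt.eventually_const_lt (hp v hv)
  exact h1.inter (h2.union h3)

open PolyVectorOpt in
theorem dense_regularPolys {n d : ℕ} (hn : 0 < n) (C : Set (E n)) :
    Dense (regularPolys n d C) := by
  intro p
  by_cases hp : p ∈ regularPolys n d C
  · exact subset_closure hp
  suffices h : ∃ r : P n d, ∀ t : ℝ, t < 0 → p + t • r ∈ regularPolys n d C by
    obtain ⟨r, hr⟩ := h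
    have ht : Tendsto (fun t : ℝ => p + t • r) (𝓝[<] 0) (𝓝 p) := by
      have := (continuous_add_smul p r).tendsto 0
      rw [zero_smul, add_zero] at this
      exact this.mono_left nhdsWithin_le_nhds
    exact mem_closure_of_tendsto ht (eventually_nhdsWithin_of_forall hr)
  -- A nonpositive value at a nonzero `v` of the cone becomes negative on subtracting a small
  -- multiple of a form equal to `1` at `v`.
  by_cases hv : ∃ v ∈ C, v ≠ 0 ∧ leadingForm p v ≤ 0
  · obtain ⟨v, hvC, hv0, hv⟩ := hv
    obtain ⟨r, hr⟩ := exists_leadingForm_eq_one (d := d) hv0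
    refine ⟨r, fun t ht => ?_⟩
    have hneg : leadingForm (p + t • r) v < 0 := by
      rw [leadingForm_add_smul, hr]
      linarith
    exact ⟨⟨v, hneg.ne⟩, Or.inl ⟨v, hvC, hneg⟩⟩
  -- The form is now positive on `C ∖ {0}`, so `p` can only fail by having zero leading form. Then
  -- `C ⊆ {0}`, positivity is vacuous, and any nonzero form serves as perturbation.
  · push Not at hv
    have hzero : ∀ v, leadingForm p v = 0 := by
      by_contra! h
      exact hp ⟨h, Or.inr hv⟩
    have : Nonempty (Fin n) := ⟨⟨0, hn⟩⟩
    obtain ⟨e, he⟩ := exists_ne (0 : E n)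
    obtain ⟨r, hr⟩ := exists_leadingForm_eq_one (d := d) he
    refine ⟨r, fun t ht => ⟨⟨e, ?_⟩, Or.inr fun v hvC hv0 => ?_⟩⟩
    · rw [leadingForm_add_smul, hr, hzero, zero_add, mul_one]
      exact ht.ne
    · exact absurd (hzero v) (hv v hvC hv0).ne'

open PolyVectorOpt in
theorem totalDegree_eq_of_mem_regularPolys {n d : ℕ} {C : Set (E n)} {p : P n d}
    (hp : p ∈ regularPolys n d C) : p.1.totalDegree = d := by
  obtain ⟨⟨v, hv⟩, -⟩ := hp
  refine le_antisymm ((mem_restrictTotalDegree _ _ _).1 p.2) (not_lt.1 fun h => hv ?_)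
  rw [leadingForm, homogeneousComponent_eq_zero _ _ h]
  simp [ev]

open PolyVectorOpt in
theorem isRegularOn_of_mem_regularPolys {n d : ℕ} (hd : 1 ≤ d) {S : Set (E n)}
    (hS : S.Nonempty) {p : P n d} (hp : p ∈ regularPolys n d (asymptoticCone ℝ S)) :
    IsRegularOn S p.1 := by
  have hdeg := totalDegree_eq_of_mem_regularPolys hp
  have hrec : recession p.1 p.1.totalDegree = leadingForm p := by
    ext x
    rw [hdeg, recession_eq hdeg.le, leadingForm]
  unfold IsRegularOn
  rw [hrec]
  refine (Bornology.isBounded_singleton (x := (0 : E n))).subset fun x hx => ?_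
  obtain ⟨hxC, hmin⟩ := hx
  rcases hp.2 with ⟨v, hvC, hv⟩ | hpos
  -- The minimum would be negative, and doubling the minimizer multiplies it by `2 ^ d > 1`.
  · have hlt := (hmin v hvC).trans_lt hv
    have h2 := hmin ((2 : ℝ) • x) (smul_mem_asymptoticCone (by norm_num) hxC)
    rw [leadingForm_smul] at h2
    have h3 : (1 : ℝ) < 2 ^ d := one_lt_pow₀ (by norm_num) (by omega)
    nlinarith
  -- The origin lies in the cone and has value `0`, since `d ≥ 1`, so it beats every nonzero point.
  · by_contra hx0
    have h0 := hmin ((0 : ℝ) • x) (by rw [zero_smul]; exact zero_mem_asymptoticCone.2 hS)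
    rw [leadingForm_smul, zero_pow (by omega), zero_mul] at h0
    exact absurd (hpos x hxC hx0) h0.not_gt

open PolyVectorOpt in
theorem continuous_ev {n : ℕ} (p : MvPolynomial (Fin n) ℝ) : Continuous (ev p) := by
  unfold ev
  exact (MvPolynomial.continuous_eval p).comp (by fun_prop)

theorem theorem6p3 {n m l q : ℕ} (hn : 0 < n) (hq : 0 < q)
    (d : Fin q → ℕ) (hd : ∀ i, 1 ≤ d i)
    (g : Fin m → MvPolynomial (Fin n) ℝ)
    (hg : ∀ i, ConvexOn ℝ Set.univ (PolyVectorOpt.ev (g i)))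
    (K : Set (PolyVectorOpt.E n))
    (hK : K = {x | ∀ i, PolyVectorOpt.ev (g i) x ≤ 0}) (hKne : K.Nonempty)
    (A : Matrix (Fin l) (Fin n) ℝ) (hA : A.rank = min l n)
    (hKinf : asymptoticCone ℝ K = {x | ∀ i, A.mulVec (fun j => x j) i ≤ 0}) :
    PolyVectorOpt.IsGeneric (PolyVectorOpt.GR K d) := by
  open PolyVectorOpt in
  have hKclosed : IsClosed K := by
    rw [hK, Set.ofPred_forall]
    exact isClosed_iInter fun i => isClosed_le (continuous_ev (g i)) continuous_const
  let U : Set (PVec n d) := Set.univ.pi fun i => regularPolys n (d i) (asymptoticCone ℝ K)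
  have hUo : IsOpen U := isOpen_set_pi Set.finite_univ fun i _ =>
    isOpen_regularPolys isClosed_asymptoticCone fun c hc v hv =>
      smul_mem_asymptoticCone hc.le hv
  have hUd : Dense U := dense_pi _ fun i _ => dense_regularPolys hn _
  refine ⟨fun _ => U, fun _ => hUo, fun _ => hUd, (Set.iInter_subset _ 0).trans fun p hp => ?_⟩
  have hp' : ∀ i, p i ∈ regularPolys n (d i) (asymptoticCone ℝ K) := fun i => hp i trivial
  obtain ⟨x₀, hx₀⟩ := hKne
  let i₀ : Fin q := ⟨0, hq⟩
  -- With `S = K` any `x₀` in `K` will do, and the weight vector `Pi.single i₀ 1` reduces the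
  -- weighted sum to `p i₀`.
  refine ⟨fun i => totalDegree_eq_of_mem_regularPolys (hp' i), K, {i₀}, Set.singleton_nonempty _,
    ⟨x₀, hx₀⟩, hKclosed, x₀, hx₀, asymptoticCone_mono fun x hx => hx.1, subset_rfl,
    Pi.single i₀ 1, fun i => ?_, ?_, ?_, ?_⟩
  · by_cases h : i = i₀
    · simp [h]
    · simp [h]
  · simp
  · ext i
    simp [Pi.single_apply]
  · rw [Finset.sum_eq_single i₀ (fun i _ h => by simp [h]) (by simp), Pi.single_eq_same, one_smul]
    exact isRegularOn_of_mem_regularPolys (hd i₀) ⟨x₀, hx₀⟩ (hp' i₀)
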